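/- Let $T,D,a\in\mathbb{R}$ with $a^2+D^2\neq 0$, and consider the planar linear system in Liénard form \[ \dot x = Tx-y,\qquad \dot y = Dx-a . \] For $y_0\ge 0$ let $\Phi(t;y_0)=(\Phi_1(t;y_0),\Phi_2(t;y_0))$ be its solution with $\Phi(0;y_0)=(0,y_0)$. The left Poincaré half-map $P$ associated with the section $\{x=0\}$ is defined as follows: if there is $\tau>0$ with $\Phi_1(\tau;y_0)=0$ and $\Phi_1(t;y_0)<0$ for all $t\in(0,\tau)$ (such a $\tau$ is unique), then $P(y_0)=\Phi_2(\tau;y_0)$; moreover, if there is no such $\tau$ for $y_0=0$ but for every $\varepsilon>0$ there are $y_0\in(0,\varepsilon)$ and $y_1\in(-\varepsilon,0)$ with $P(y_0)=y_1$, then $P(0)=0$. Let $I\subset[0,+\infty)$ be the set of all $y_0$ at which $P$ is so defined, and let $\operatorname{int}(I)$ be its interior in $\mathbb{R}$. Then $P$ is twice differentiable on $\operatorname{int}(I)$ and \[ \operatorname{sign}\!\left(\frac{d^2P}{dy_0^2}(y_0)\right)=-\operatorname{sign}(a^2T)\qquad\text{for every } y_0\in\operatorname{int}(I). \] -/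

import Mathlib

namespace PoincareHalfMap

/-- `(x, y) : ℝ → ℝ × ℝ` is a (global) solution of the planar linear system in Liénard form
`x' = T x - y`, `y' = D x - a`. -/
def IsSolution (T D a : ℝ) (x y : ℝ → ℝ) : Prop :=
  ∀ t : ℝ, HasDerivAt x (T * x t - y t) t ∧ HasDerivAt y (D * x t - a) t

/-- The orbit of the system through `(0, y₀)` returns to the line `x = 0` at `(0, y₁)`, at some time
`τ > 0` (the left flight time), after staying in the open half-plane `x < 0` on `(0, τ)`. -/
def LeftReturn (T D a y₀ y₁ : ℝ) : Prop :=
  ∃ (x y : ℝ → ℝ) (τ : ℝ), IsSolution T D a x y ∧ x 0 = 0 ∧ y 0 = y₀ ∧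
    0 < τ ∧ x τ = 0 ∧ y τ = y₁ ∧ ∀ t ∈ Set.Ioo 0 τ, x t < 0

/-- Uniqueness of the solution with given initial condition. -/
theorem IsSolution.unique {T D a : ℝ} {x y u v : ℝ → ℝ} (h : IsSolution T D a x y)
    (k : IsSolution T D a u v) (hx : x 0 = u 0) (hy : y 0 = v 0) : x = u ∧ y = v := by
  let L : ℝ × ℝ →L[ℝ] ℝ × ℝ :=
    (T • ContinuousLinearMap.fst ℝ ℝ ℝ - ContinuousLinearMap.snd ℝ ℝ ℝ).prod
      (D • ContinuousLinearMap.fst ℝ ℝ ℝ)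
  have hL : LipschitzWith (‖L‖₊ + 0) (fun p : ℝ × ℝ => L p - (0, a)) :=
    L.lipschitz.sub (LipschitzWith.const _)
  have key : ∀ {p q : ℝ → ℝ}, IsSolution T D a p q → ∀ t : ℝ,
      HasDerivAt (fun s => (p s, q s)) (L (p t, q t) - (0, a)) t := by
    intro p q hpq t
    have := (hpq t).1.prodMk (hpq t).2
    convert this using 1
    simp [L]
  have e := ODE_solution_unique_univ (v := fun _ p => L p - (0, a)) (s := fun _ => Set.univ)
    (t₀ := 0) (fun _ => hL.lipschitzOnWith)
    (fun t => ⟨key h t, Set.mem_univ _⟩) (fun t => ⟨key k t, Set.mem_univ _⟩)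
    (by simp [hx, hy])
  exact ⟨funext fun t => congrArg Prod.fst (congrFun e t),
    funext fun t => congrArg Prod.snd (congrFun e t)⟩

/-- The return point is unique, so `LeftReturn` is the graph of a function of `y₀`. -/
theorem LeftReturn.unique {T D a y₀ y₁ z₁ : ℝ} (h : LeftReturn T D a y₀ y₁)
    (k : LeftReturn T D a y₀ z₁) : y₁ = z₁ := by
  obtain ⟨x, y, τ, hs, hx, hy, hτ, hxτ, hyτ, hneg⟩ := h
  obtain ⟨u, v, σ, ks, kx, ky, hσ, kxσ, kyσ, kneg⟩ := k
  obtain ⟨rfl, rfl⟩ := hs.unique ks (hx.trans kx.symm) (hy.trans ky.symm)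
  rcases lt_trichotomy τ σ with hlt | rfl | hlt
  · exact absurd hxτ (kneg τ ⟨hτ, hlt⟩).ne
  · exact hyτ.symm.trans kyσ
  · exact absurd kxσ (hneg σ ⟨hσ, hlt⟩).ne

/-- The domain `I ⊆ [0, ∞)` of the left Poincaré half-map: the points `y₀ ≥ 0` whose orbit returns,
together with the origin when the half-map extends continuously to it by the value `0`. -/
def leftDomain (T D a : ℝ) : Set ℝ :=
  {y₀ | 0 ≤ y₀ ∧ ((∃ y₁, LeftReturn T D a y₀ y₁) ∨
    (y₀ = 0 ∧ ∀ ε > 0, ∃ z₀ ∈ Set.Ioo 0 ε, ∃ z₁ ∈ Set.Ioo (-ε) 0, LeftReturn T D a z₀ z₁))}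

open Classical in
/-- The left Poincaré half-map `P`: the return point where the orbit returns. The value `0` in the
other case is the extension to the origin (and has no meaning outside `leftDomain`). -/
noncomputable def leftMap (T D a : ℝ) (y₀ : ℝ) : ℝ :=
  if h : ∃ y₁, LeftReturn T D a y₀ y₁ then h.choose else 0

/-- Where the orbit returns, `leftMap` is the return point. -/
theorem LeftReturn.leftMap_eq {T D a y₀ y₁ : ℝ} (h : LeftReturn T D a y₀ y₁) :
    leftMap T D a y₀ = y₁ := by
  have hex : ∃ y₁, LeftReturn T D a y₀ y₁ := ⟨y₁, h⟩
  rw [leftMap, dif_pos hex]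
  exact hex.choose_spec.unique h

end PoincareHalfMap

/-!
Write the solution through `(0, y)` as `x = a R - y S`, where `R'' = T R' - D R + 1` with zero initial
data and `S = R'`, and put `W(y) = D y² - a T y + a²`. If the orbit returns at time `τ` at the height
`z`, then `R W(y) = y (y - z)`, `S W(y) = a (y - z)` and `S' W(y) = (D y - a T) z + a²` at time `τ`.
With Liouville's formula `S'² - T S S' + D S² = exp (T t)` this gives `W(z) = exp (T τ) W(y)`, and for
`a ≠ 0` both values are positive (`IsStepResponse.polyW_pos`).

Over an interior point of the domain `y > 0` and `z < 0`: a tangential return `z = 0` is excluded by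
an energy argument (`IsStepResponse.return_ne_zero`). The return is then transversal, so the implicit
function theorem, and a compactness argument that keeps it the first return, give a differentiable
flight time (`IsStepResponse.exists_flightTime`). Hence `P' = y W(P) / (P W(y))`
(`IsStepResponse.hasDerivAt_leftMap`), and differentiating once more,
`P'' = a² W(P) (P² - y²) / (P³ W(y)²)`.

The energy `x'² / 2 + D x² / 2 - a x` has derivative `T x'²` along orbits and equals `y² / 2` on the
section, so `P² - y²` is a positive multiple of `T` (`IsSolution.exists_sq_sub_sq`). Since `P³ < 0`,
the sign of `P''` is opposite to that of `a² T`.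
-/

open Filter Topology Set

namespace PoincareHalfMap

/-! ### Solutions through the section -/

/-- `R` solves `R'' = T R' - D R + 1` with `R(0) = R'(0) = 0`, and `S = R'`. Hence `S`
solves the homogeneous equation `S'' = T S' - D S` with `S(0) = 0` and `S'(0) = 1`. -/
structure IsStepResponse (T D : ℝ) (R S : ℝ → ℝ) : Prop where
  R_zero : R 0 = 0
  S_zero : S 0 = 0
  hasDerivAt_R : ∀ t, HasDerivAt R (S t) t
  hasDerivAt_S : ∀ t, HasDerivAt S (T * S t - D * R t + 1) t

theorem exists_isStepResponse (T D : ℝ) : ∃ R S : ℝ → ℝ, IsStepResponse T D R S := by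
  -- The inhomogeneous equation becomes the linear one `(r, s, c)' = (s, T s - D r + c, 0)`.
  let A : ℝ × ℝ × ℝ →L[ℝ] ℝ × ℝ × ℝ :=
    ((ContinuousLinearMap.fst ℝ ℝ ℝ).comp (ContinuousLinearMap.snd ℝ ℝ (ℝ × ℝ))).prod
      ((T • (ContinuousLinearMap.fst ℝ ℝ ℝ).comp (ContinuousLinearMap.snd ℝ ℝ (ℝ × ℝ))
        - D • ContinuousLinearMap.fst ℝ ℝ (ℝ × ℝ)
        + (ContinuousLinearMap.snd ℝ ℝ ℝ).comp (ContinuousLinearMap.snd ℝ ℝ (ℝ × ℝ))).prod 0)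
  let u : ℝ → ℝ × ℝ × ℝ := fun t => NormedSpace.exp (t • A) (0, 0, 1)
  have hu0 : u 0 = (0, 0, 1) := by simp [u]
  have hu : ∀ t, HasDerivAt u (A (u t)) t := fun t => by
    have h := (hasDerivAt_exp_smul_const' (𝕂 := ℝ) A t).clm_apply
      (hasDerivAt_const t ((0, 0, 1) : ℝ × ℝ × ℝ))
    simpa [u] using h
  have h1 : ∀ t, HasDerivAt (fun t => (u t).1) ((u t).2.1) t := fun t =>
    (ContinuousLinearMap.fst ℝ ℝ (ℝ × ℝ)).hasFDerivAt.comp_hasDerivAt t (hu t)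
  have h2 : ∀ t, HasDerivAt (fun t => (u t).2.1) (T * (u t).2.1 - D * (u t).1 + (u t).2.2) t :=
    fun t => ((ContinuousLinearMap.fst ℝ ℝ ℝ).comp
      (ContinuousLinearMap.snd ℝ ℝ (ℝ × ℝ))).hasFDerivAt.comp_hasDerivAt t (hu t)
  have h3 : ∀ t, HasDerivAt (fun t => (u t).2.2) 0 t :=
    fun t => ((ContinuousLinearMap.snd ℝ ℝ ℝ).comp
      (ContinuousLinearMap.snd ℝ ℝ (ℝ × ℝ))).hasFDerivAt.comp_hasDerivAt t (hu t)
  have h4 : ∀ t, (u t).2.2 = 1 := fun t => by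
    have := is_const_of_deriv_eq_zero (fun t => (h3 t).differentiableAt) (fun t => (h3 t).deriv) t 0
    simpa [hu0] using this
  exact ⟨fun t => (u t).1, fun t => (u t).2.1, by simp [hu0], by simp [hu0], h1,
    fun t => by simpa only [h4] using h2 t⟩

/-- First coordinate at time `t` of the solution through `(0, y)`. -/
def orbitX (a : ℝ) (R S : ℝ → ℝ) (y t : ℝ) : ℝ := a * R t - y * S t

/-- Second coordinate at time `t` of the solution through `(0, y)`. -/
def orbitY (T D a : ℝ) (R S : ℝ → ℝ) (y t : ℝ) : ℝ := y * (1 - D * R t) + a * (T * R t - S t)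

/-- The polynomial `W(y) = D y² - a T y + a²` that governs the derivative of the half-map. -/
def polyW (T D a y : ℝ) : ℝ := D * y ^ 2 - a * T * y + a ^ 2

section

variable {T D a : ℝ} {R S : ℝ → ℝ}

theorem IsStepResponse.continuous_R (h : IsStepResponse T D R S) : Continuous R :=
  continuous_iff_continuousAt.2 fun t => (h.hasDerivAt_R t).continuousAt

theorem IsStepResponse.continuous_S (h : IsStepResponse T D R S) : Continuous S :=
  continuous_iff_continuousAt.2 fun t => (h.hasDerivAt_S t).continuousAt

theorem IsStepResponse.isSolution (h : IsStepResponse T D R S) (a y : ℝ) :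
    IsSolution T D a (orbitX a R S y) (orbitY T D a R S y) := fun t => by
  constructor
  · refine (((h.hasDerivAt_R t).const_mul a).sub ((h.hasDerivAt_S t).const_mul y)).congr_deriv ?_
    simp only [orbitX, orbitY]; ring
  · refine (((((h.hasDerivAt_R t).const_mul D).const_sub 1).const_mul y).add
      ((((h.hasDerivAt_R t).const_mul T).sub (h.hasDerivAt_S t)).const_mul a)).congr_deriv ?_
    simp only [orbitX]; ring

theorem IsStepResponse.orbitX_zero (h : IsStepResponse T D R S) (y : ℝ) :
    orbitX a R S y 0 = 0 := by simp [orbitX, h.R_zero, h.S_zero]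

theorem IsStepResponse.orbitY_zero (h : IsStepResponse T D R S) (y : ℝ) :
    orbitY T D a R S y 0 = y := by simp [orbitY, h.R_zero, h.S_zero]

theorem IsStepResponse.continuous_orbitX (h : IsStepResponse T D R S) (a : ℝ) :
    Continuous fun p : ℝ × ℝ => orbitX a R S p.1 p.2 := by
  have := h.continuous_R
  have := h.continuous_S
  unfold orbitX; fun_prop

theorem IsStepResponse.continuous_orbitY (h : IsStepResponse T D R S) (a : ℝ) :
    Continuous fun p : ℝ × ℝ => orbitY T D a R S p.1 p.2 := by
  have := h.continuous_R
  have := h.continuous_S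
  unfold orbitY; fun_prop

theorem IsStepResponse.leftReturn_iff (h : IsStepResponse T D R S) {y z : ℝ} :
    LeftReturn T D a y z ↔ ∃ τ, 0 < τ ∧ orbitX a R S y τ = 0 ∧ orbitY T D a R S y τ = z ∧
      ∀ t ∈ Ioo 0 τ, orbitX a R S y t < 0 := by
  constructor
  · rintro ⟨u, v, τ, hs, hu, hv, hτ, huτ, hvτ, hneg⟩
    obtain ⟨rfl, rfl⟩ := hs.unique (h.isSolution a y) (hu.trans (h.orbitX_zero y).symm)
      (hv.trans (h.orbitY_zero y).symm)
    exact ⟨τ, hτ, huτ, hvτ, hneg⟩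
  · rintro ⟨τ, hτ, hx, hy, hneg⟩
    exact ⟨_, _, τ, h.isSolution a y, h.orbitX_zero y, h.orbitY_zero y, hτ, hx, hy, hneg⟩

/-- Liouville's formula for the companion system of `S`. -/
theorem IsStepResponse.wronskian (h : IsStepResponse T D R S) (t : ℝ) :
    (T * S t - D * R t + 1) ^ 2 - T * S t * (T * S t - D * R t + 1) + D * S t ^ 2 =
      Real.exp (T * t) := by
  set Q : ℝ → ℝ := fun t => T * S t - D * R t + 1 with hQ
  have dQ : ∀ t, HasDerivAt Q (T * Q t - D * S t) t := fun t =>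
    (((h.hasDerivAt_S t).const_mul T).sub ((h.hasDerivAt_R t).const_mul D)).add_const 1
  have dS : ∀ t, HasDerivAt S (Q t) t := h.hasDerivAt_S
  have dE : ∀ t, HasDerivAt
      (fun t => (Q t ^ 2 - T * S t * Q t + D * S t ^ 2) * Real.exp (-(T * t))) 0 t := fun t => by
    have e : HasDerivAt (fun t => Real.exp (-(T * t))) (Real.exp (-(T * t)) * -(T * 1)) t :=
      (((hasDerivAt_id t).const_mul T).neg).exp
    refine (((((dQ t).pow 2).sub (((dS t).const_mul T).mul (dQ t))).add
      (((dS t).pow 2).const_mul D)).mul e).congr_deriv ?_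
    simp; ring
  have := is_const_of_deriv_eq_zero (fun t => (dE t).differentiableAt) (fun t => (dE t).deriv) t 0
  simp only [hQ, h.S_zero, h.R_zero] at this
  rw [Real.exp_neg] at this
  have hpos := Real.exp_pos (T * t)
  field_simp at this
  simp at this
  linarith

end

/-! ### Energy balance -/

section

variable {T D a : ℝ} {x y : ℝ → ℝ}

/-- The energy `x'² / 2 + D x² / 2 - a x` has derivative `T x'²`, where `x' = T x - y`. -/
theorem IsSolution.energy_sub (h : IsSolution T D a x y) (r s : ℝ) :
    ((T * x s - y s) ^ 2 / 2 + D * x s ^ 2 / 2 - a * x s) -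
      ((T * x r - y r) ^ 2 / 2 + D * x r ^ 2 / 2 - a * x r) =
      T * ∫ t in r..s, (T * x t - y t) ^ 2 := by
  have cx : Continuous x := continuous_iff_continuousAt.2 fun t => (h t).1.continuousAt
  have cy : Continuous y := continuous_iff_continuousAt.2 fun t => (h t).2.continuousAt
  rw [← intervalIntegral.integral_const_mul]
  refine (intervalIntegral.integral_eq_sub_of_hasDerivAt
    (f := fun s => (T * x s - y s) ^ 2 / 2 + D * x s ^ 2 / 2 - a * x s) (fun t _ => ?_)
    (Continuous.intervalIntegrable (by fun_prop) _ _)).symm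
  refine (((((((h t).1.const_mul T).sub (h t).2).pow 2).div_const 2).add
    ((((h t).1.pow 2).const_mul D).div_const 2)).sub ((h t).1.const_mul a)).congr_deriv ?_
  simp; ring

theorem IsSolution.integral_sq_pos (h : IsSolution T D a x y) {r s c : ℝ} (hrs : r < s)
    (hc : c ∈ Icc r s) (hxc : T * x c - y c ≠ 0) : 0 < ∫ t in r..s, (T * x t - y t) ^ 2 := by
  have cx : Continuous x := continuous_iff_continuousAt.2 fun t => (h t).1.continuousAt
  have cy : Continuous y := continuous_iff_continuousAt.2 fun t => (h t).2.continuousAt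
  exact intervalIntegral.integral_pos hrs (Continuous.continuousOn (by fun_prop))
    (fun t _ => sq_nonneg _) ⟨c, hc, by positivity⟩

/-- Between two crossings of `x = 0` the change of `y²` has the sign of `T`. -/
theorem IsSolution.exists_sq_sub_sq (h : IsSolution T D a x y) {r s : ℝ} (hrs : r < s)
    (hr : x r = 0) (hs : x s = 0) (hy : y r ≠ 0) : ∃ A > 0, y s ^ 2 - y r ^ 2 = T * A := by
  refine ⟨2 * ∫ t in r..s, (T * x t - y t) ^ 2, ?_, ?_⟩
  · exact mul_pos two_pos (h.integral_sq_pos hrs (left_mem_Icc.2 hrs.le) (by simpa [hr] using hy))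
  · have := h.energy_sub r s
    simp only [hr, hs] at this
    linarith

end

/-! ### Algebra at a return -/

section

variable {T D a r s y z : ℝ}

theorem return_relation_R (hx : a * r = y * s) (hz : y * (1 - D * r) + a * (T * r - s) = z) :
    r * polyW T D a y = y * (y - z) := by
  unfold polyW; linear_combination a * hx + -y * hz

theorem return_relation_S (hx : a * r = y * s) (hz : y * (1 - D * r) + a * (T * r - s) = z) :
    s * polyW T D a y = a * (y - z) := by
  unfold polyW; linear_combination (a * T - D * y) * hx - a * hz

theorem return_relation_derivS (hx : a * r = y * s)
    (hz : y * (1 - D * r) + a * (T * r - s) = z) :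
    (T * s - D * r + 1) * polyW T D a y = (D * y - a * T) * z + a ^ 2 := by
  have h1 := return_relation_R hx hz
  have h2 := return_relation_S hx hz
  have h3 : polyW T D a y = D * y ^ 2 - a * T * y + a ^ 2 := rfl
  linear_combination T * h2 - D * h1 + h3

end

/-! ### Positivity of `W` at the ends of a returning orbit -/

section

variable {T D a : ℝ} {R S : ℝ → ℝ}

theorem polyW_ne_zero_of_return {y z τ : ℝ} (hy : 0 < y)
    (hz : z ≤ 0) (hx : orbitX a R S y τ = 0) (hY : orbitY T D a R S y τ = z) :
    polyW T D a y ≠ 0 := by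
  intro h0
  have := return_relation_R (sub_eq_zero.1 hx) hY
  rw [h0, mul_zero] at this
  nlinarith [mul_pos hy hy, mul_nonneg hy.le (neg_nonneg.2 hz)]

/-- The polynomial `W` grows by the factor `exp (T τ)` from the start of an orbit to its return. -/
theorem IsStepResponse.polyW_return (h : IsStepResponse T D R S) {y z τ : ℝ} (hy : 0 < y)
    (hz : z ≤ 0) (hx : orbitX a R S y τ = 0) (hY : orbitY T D a R S y τ = z) :
    polyW T D a z = Real.exp (T * τ) * polyW T D a y := by
  apply mul_right_cancel₀ (polyW_ne_zero_of_return hy hz hx hY)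
  have h1 := return_relation_S (sub_eq_zero.1 hx) hY
  have h2 := return_relation_derivS (sub_eq_zero.1 hx) hY
  rw [← h.wronskian τ]
  set W := polyW T D a y
  set Q := T * S τ - D * R τ + 1
  have e : (Q ^ 2 - T * S τ * Q + D * S τ ^ 2) * W * W =
      (Q * W) ^ 2 - T * (S τ * W) * (Q * W) + D * (S τ * W) ^ 2 := by ring
  rw [e, h1, h2]
  simp only [W, polyW]
  ring

/-- `W` is positive at the two ends of a returning orbit. If it were negative at both, the signs of
its values would force `D < 0`; then `S' (S' - T S) > 0` keeps `S'`, hence `S` and `R`, positive,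
against `R(τ) W(y) = y (y - z)`. -/
theorem IsStepResponse.polyW_pos (h : IsStepResponse T D R S) (ha : a ≠ 0) {y z τ : ℝ}
    (hτ : 0 < τ) (hy : 0 < y) (hz : z < 0) (hx : orbitX a R S y τ = 0)
    (hY : orbitY T D a R S y τ = z) : 0 < polyW T D a y := by
  by_contra hle
  have hW : polyW T D a y < 0 := lt_of_le_of_ne (not_lt.1 hle) (polyW_ne_zero_of_return hy hz.le hx hY)
  have hWz : polyW T D a z < 0 := by
    rw [h.polyW_return hy hz.le hx hY]
    exact mul_neg_of_pos_of_neg (Real.exp_pos _) hW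
  have ha2 : 0 < a ^ 2 := by positivity
  have hD : D < 0 := by
    by_contra hD
    have e : (-z) * polyW T D a y + y * polyW T D a z = (y - z) * (a ^ 2 + D * (y * -z)) := by
      unfold polyW; ring
    have h1 : 0 < (y - z) * (a ^ 2 + D * (y * -z)) :=
      mul_pos (by linarith) (add_pos_of_pos_of_nonneg ha2
        (mul_nonneg (not_lt.1 hD) (mul_nonneg hy.le (by linarith))))
    have h2 := mul_neg_of_pos_of_neg (neg_pos.2 hz) hW
    have h3 := mul_neg_of_pos_of_neg hy hWz
    linarith
  have cR := h.continuous_R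
  have cS := h.continuous_S
  have hQ0 : ∀ t, T * S t - D * R t + 1 ≠ 0 := fun t h0 => by
    have h1 := h.wronskian t
    rw [h0] at h1
    nlinarith [Real.exp_pos (T * t), mul_nonneg (neg_pos.2 hD).le (sq_nonneg (S t))]
  have hQ : ∀ t, 0 < T * S t - D * R t + 1 := fun t => by
    by_contra hneg
    have hcont : Continuous fun t => T * S t - D * R t + 1 := by fun_prop
    obtain ⟨c, hc⟩ := mem_range_of_exists_le_of_exists_ge hcont ⟨t, not_lt.1 hneg⟩
      ⟨0, by simp [h.R_zero, h.S_zero]⟩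
    exact hQ0 c hc
  have mS : StrictMono S := strictMono_of_deriv_pos fun t => by
    rw [(h.hasDerivAt_S t).deriv]; exact hQ t
  have mR : StrictMonoOn R (Ici 0) :=
    strictMonoOn_of_deriv_pos (convex_Ici 0) cR.continuousOn fun t ht => by
      rw [interior_Ici] at ht
      rw [(h.hasDerivAt_R t).deriv, ← h.S_zero]; exact mS ht
  have hR : 0 < R τ := by
    have := mR self_mem_Ici hτ.le hτ
    rwa [h.R_zero] at this
  have h1 := return_relation_R (sub_eq_zero.1 hx) hY
  have h2 : 0 < y * (y - z) := mul_pos hy (by linarith)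
  have h3 := mul_neg_of_pos_of_neg hR hW
  linarith

/-! ### Returns are transversal -/

theorem IsStepResponse.return_nonpos (h : IsStepResponse T D R S) {y z τ : ℝ}
    (hτ : 0 < τ) (hx : orbitX a R S y τ = 0) (hY : orbitY T D a R S y τ = z)
    (hneg : ∀ t ∈ Ioo 0 τ, orbitX a R S y t < 0) : z ≤ 0 := by
  have hd := (h.isSolution a y τ).1
  rw [hx, hY] at hd
  have hs := hd.tendsto_slope.mono_left
    (nhdsWithin_mono τ (show Iio τ ⊆ {τ}ᶜ from fun t (ht : t < τ) => ht.ne))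
  have : 0 ≤ T * 0 - z := by
    refine ge_of_tendsto hs ?_
    filter_upwards [Ioo_mem_nhdsLT hτ] with t ht
    rw [slope_def_field, hx]
    exact div_nonneg_of_nonpos (by linarith [hneg t ht]) (by linarith [ht.2])
  linarith

/-- Where `x'` is nonzero, nearby orbits are uniformly monotone; the factor `c` carries the sign. -/
theorem IsStepResponse.exists_strictMonoOn (h : IsStepResponse T D R S) {y₀ t₀ c : ℝ}
    (hc : 0 < c * (T * orbitX a R S y₀ t₀ - orbitY T D a R S y₀ t₀)) :
    ∃ ε > 0, ∀ y ∈ Metric.ball y₀ ε,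
      StrictMonoOn (fun t => c * orbitX a R S y t) (Metric.ball t₀ ε) := by
  have cX := h.continuous_orbitX a
  have cY := h.continuous_orbitY a
  have hcont : Continuous fun p : ℝ × ℝ =>
      c * (T * orbitX a R S p.1 p.2 - orbitY T D a R S p.1 p.2) := by fun_prop
  have hev : ∀ᶠ p in 𝓝 (y₀, t₀), 0 < c * (T * orbitX a R S p.1 p.2 - orbitY T D a R S p.1 p.2) :=
    hcont.continuousAt.eventually_const_lt hc
  obtain ⟨ε, hε, hball⟩ := Metric.eventually_nhds_iff_ball.1 hev
  refine ⟨ε, hε, fun y hy => ?_⟩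
  have hd : ∀ t, HasDerivAt (fun t => c * orbitX a R S y t)
      (c * (T * orbitX a R S y t - orbitY T D a R S y t)) t :=
    fun t => ((h.isSolution a y t).1).const_mul c
  refine strictMonoOn_of_deriv_pos (convex_ball t₀ ε)
    (fun t _ => (hd t).continuousAt.continuousWithinAt) fun t ht => ?_
  rw [Metric.isOpen_ball.interior_eq] at ht
  rw [(hd t).deriv]
  refine hball (y, t) ?_
  rw [← ball_prod_same]
  exact ⟨hy, ht⟩

theorem IsStepResponse.eventually_neg_at_start (h : IsStepResponse T D R S) {y₀ : ℝ}
    (hy : 0 < y₀) : ∀ᶠ p : ℝ × ℝ in 𝓝 (y₀, 0), 0 < p.2 → orbitX a R S p.1 p.2 < 0 := by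
  obtain ⟨ε, hε, hm⟩ := h.exists_strictMonoOn (a := a) (y₀ := y₀) (t₀ := 0) (c := -1)
    (by rw [h.orbitX_zero, h.orbitY_zero]; linarith)
  have := prod_mem_nhds (Metric.ball_mem_nhds y₀ hε) (Metric.ball_mem_nhds (0 : ℝ) hε)
  filter_upwards [this] with p hp h0
  have := hm p.1 hp.1 (Metric.mem_ball_self hε) hp.2 h0
  simp only [h.orbitX_zero] at this
  linarith

theorem IsStepResponse.eventually_neg_inside (h : IsStepResponse T D R S) {y₀ t₀ : ℝ}
    (hx : orbitX a R S y₀ t₀ < 0) : ∀ᶠ p : ℝ × ℝ in 𝓝 (y₀, t₀), orbitX a R S p.1 p.2 < 0 :=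
  (h.continuous_orbitX a).continuousAt.eventually_lt_const hx

/-- Near an interior point of the domain an orbit cannot return tangentially. If `z = 0`, then
`x'' = a` at the return; `a > 0` contradicts the approach from `x < 0`, and `a = 0` gives
`S = S' = 0`. If `a < 0`, the energy vanishes at the return and decreases strictly, and on one side
of `y₀` nearby orbits miss the line `x = 0` until their energy is negative, so they never return. -/
theorem IsStepResponse.return_ne_zero (h : IsStepResponse T D R S) {y₀ τ : ℝ}
    (hy : 0 < y₀) (hτ : 0 < τ) (hx : orbitX a R S y₀ τ = 0)
    (hneg : ∀ t ∈ Ioo 0 τ, orbitX a R S y₀ t < 0)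
    (hI : ∀ᶠ y in 𝓝 y₀, ∃ z, LeftReturn T D a y z) : orbitY T D a R S y₀ τ ≠ 0 := by
  intro hY
  have hsol := h.isSolution a y₀
  have cS := h.continuous_S
  have hW := polyW_ne_zero_of_return hy le_rfl hx hY
  have hSW := return_relation_S (sub_eq_zero.1 hx) hY
  have hQW := return_relation_derivS (sub_eq_zero.1 hx) hY
  have hd2 : ∀ t, HasDerivAt (fun t => T * orbitX a R S y₀ t - orbitY T D a R S y₀ t)
      (T * (T * orbitX a R S y₀ t - orbitY T D a R S y₀ t) - (D * orbitX a R S y₀ t - a)) t :=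
    fun t => ((hsol t).1.const_mul T).sub (hsol t).2
  have hderiv : deriv (orbitX a R S y₀) =
      fun t => T * orbitX a R S y₀ t - orbitY T D a R S y₀ t := funext fun t => (hsol t).1.deriv
  have hdx : deriv (orbitX a R S y₀) τ = 0 := by rw [hderiv]; simp [hx, hY]
  have hddx : deriv (deriv (orbitX a R S y₀)) τ = a := by
    rw [hderiv, (hd2 τ).deriv]; simp [hx, hY]
  rcases lt_trichotomy a 0 with ha | ha | ha
  · have hmax := isLocalMax_of_deriv_deriv_neg (by rw [hddx]; exact ha) hdx
      (hsol τ).1.continuousAt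
    have hS : S τ ≠ 0 := fun h0 => by
      rw [h0, zero_mul] at hSW
      exact (mul_ne_zero ha.ne (by linarith : y₀ - 0 ≠ 0)) hSW.symm
    have hT : T < 0 := by
      obtain ⟨A, hA, hAe⟩ := hsol.exists_sq_sub_sq hτ (h.orbitX_zero y₀) hx
        (by rw [h.orbitY_zero]; exact hy.ne')
      rw [hY, h.orbitY_zero] at hAe
      by_contra hT
      nlinarith [mul_nonneg (not_lt.1 hT) hA.le, mul_pos hy hy]
    -- Up to a time `s` slightly after `τ`, `x ≤ 0` on the orbit and `S` keeps its sign.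
    have hmax' : ∀ᶠ t in 𝓝 τ, orbitX a R S y₀ t ≤ 0 := by
      filter_upwards [hmax] with t ht
      rwa [hx] at ht
    have hSS : ∀ᶠ t in 𝓝 τ, 0 < S τ * S t :=
      (continuous_const.mul cS).continuousAt.eventually_const_lt (mul_self_pos.2 hS)
    have hne : ∀ᶠ t in 𝓝[>] τ, T * orbitX a R S y₀ t - orbitY T D a R S y₀ t ≠ 0 := by
      have := (hd2 τ).eventually_ne (c := 0) (by simp [hx, hY]; exact ha.ne)
      exact this.filter_mono (nhdsWithin_mono τ fun t (ht : τ < t) => ht.ne')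
    obtain ⟨δ, hδ, hball⟩ := Metric.eventually_nhds_iff_ball.1 (hmax'.and hSS)
    obtain ⟨s, hs, hτs, hsδ⟩ := (hne.and (Ioo_mem_nhdsGT (by linarith : τ < τ + δ))).exists
    have hfirst : ∀ᶠ y in 𝓝 y₀, ∀ t ∈ Icc 0 s, 0 < t → 0 < (y - y₀) * S τ →
        orbitX a R S y t < 0 := by
      refine isCompact_Icc.eventually_forall_of_forall_eventually fun t ht => ?_
      rcases ht.1.eq_or_lt with rfl | ht0
      · exact (h.eventually_neg_at_start hy).mono fun p hp h0 _ => hp h0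
      rcases lt_or_ge t τ with htτ | htτ
      · exact (h.eventually_neg_inside (hneg t ⟨ht0, htτ⟩)).mono fun p hp _ _ => hp
      · have htb : t ∈ Metric.ball τ δ := by
          rw [Real.ball_eq_Ioo]; exact ⟨by linarith, by linarith [ht.2]⟩
        filter_upwards [prod_mem_nhds univ_mem (Metric.isOpen_ball.mem_nhds htb)] with p hp _ hside
        obtain ⟨h1, h2⟩ := hball p.2 hp.2
        have h3 : 0 < (p.1 - y₀) * S p.2 := by
          have : 0 < ((p.1 - y₀) * S p.2) * (S τ * S τ) := by
            calc (0 : ℝ) < ((p.1 - y₀) * S τ) * (S τ * S p.2) := mul_pos hside h2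
              _ = _ := by ring
          exact pos_of_mul_pos_left this (mul_self_nonneg _)
        have e : orbitX a R S p.1 p.2 = orbitX a R S y₀ p.2 - (p.1 - y₀) * S p.2 := by
          unfold orbitX; ring
        rw [e]; linarith
    have henergy : ∀ᶠ y in 𝓝 y₀, (T * orbitX a R S y s - orbitY T D a R S y s) ^ 2 / 2 +
        D * orbitX a R S y s ^ 2 / 2 - a * orbitX a R S y s < 0 := by
      have cX : Continuous fun y => orbitX a R S y s :=
        (h.continuous_orbitX a).comp (by fun_prop : Continuous fun y : ℝ => (y, s))
      have cY : Continuous fun y => orbitY T D a R S y s :=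
        (h.continuous_orbitY a).comp (by fun_prop : Continuous fun y : ℝ => (y, s))
      refine Continuous.continuousAt (by fun_prop) |>.eventually_lt_const ?_
      have h1 := hsol.energy_sub τ s
      have h2 := hsol.integral_sq_pos hτs (right_mem_Icc.2 hτs.le) hs
      simp only [hx, hY] at h1
      have h3 := mul_neg_of_neg_of_pos hT h2
      linarith
    have hside : ∃ᶠ y in 𝓝 y₀, 0 < (y - y₀) * S τ := by
      rcases hS.lt_or_gt with hS | hS
      · have : ∀ᶠ y in 𝓝[<] y₀, 0 < (y - y₀) * S τ := by
          filter_upwards [self_mem_nhdsWithin] with y (hy : y < y₀)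
          exact mul_pos_of_neg_of_neg (by linarith) hS
        exact this.frequently.filter_mono nhdsWithin_le_nhds
      · have : ∀ᶠ y in 𝓝[>] y₀, 0 < (y - y₀) * S τ := by
          filter_upwards [self_mem_nhdsWithin] with y (hy : y₀ < y)
          exact mul_pos (by linarith) hS
        exact this.frequently.filter_mono nhdsWithin_le_nhds
    obtain ⟨y, hsy, hfy, hey, z, hz⟩ := (hside.and_eventually (hfirst.and (henergy.and hI))).exists
    obtain ⟨σ, hσ, hxσ, -, -⟩ := h.leftReturn_iff.1 hz
    have hsσ : s < σ := by
      by_contra hle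
      exact (hfy σ ⟨hσ.le, not_lt.1 hle⟩ hσ hsy).ne hxσ
    have h1 := (h.isSolution a y).energy_sub s σ
    have h2 : 0 ≤ ∫ t in s..σ, (T * orbitX a R S y t - orbitY T D a R S y t) ^ 2 :=
      intervalIntegral.integral_nonneg hsσ.le fun t _ => sq_nonneg _
    have h3 := mul_nonpos_of_nonpos_of_nonneg hT.le h2
    simp only [hxσ] at h1
    nlinarith [sq_nonneg (orbitY T D a R S y σ)]
  · subst ha
    have hS : S τ = 0 := by
      simpa [hW] using hSW
    have hQ : T * S τ - D * R τ + 1 = 0 := by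
      simpa [hW] using hQW
    have h1 := h.wronskian τ
    rw [hQ, hS] at h1
    simp at h1
    exact (Real.exp_pos _).ne h1
  · have hmin := isLocalMin_of_deriv_deriv_pos (by rw [hddx]; exact ha) hdx
      (hsol τ).1.continuousAt
    have h1 : ∀ᶠ t in 𝓝[<] τ, orbitX a R S y₀ τ ≤ orbitX a R S y₀ t :=
      hmin.filter_mono nhdsWithin_le_nhds
    obtain ⟨t, ht1, ht2⟩ := (h1.and (Ioo_mem_nhdsLT hτ)).exists
    linarith [hneg t ht2]

/-! ### Derivatives of the half-map -/

/-- A transversal return persists: the flight time depends differentiably on `y`. -/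
theorem IsStepResponse.exists_flightTime (h : IsStepResponse T D R S) {y₀ τ z : ℝ}
    (hy : 0 < y₀) (hz : z < 0) (hτ : 0 < τ) (hx : orbitX a R S y₀ τ = 0)
    (hY : orbitY T D a R S y₀ τ = z) (hneg : ∀ t ∈ Ioo 0 τ, orbitX a R S y₀ t < 0) :
    ∃ g : ℝ → ℝ, g y₀ = τ ∧ HasDerivAt g (-(S τ / z)) y₀ ∧
      ∀ᶠ y in 𝓝 y₀, LeftReturn T D a y (orbitY T D a R S y (g y)) := by
  have cR := h.continuous_R
  have cS := h.continuous_S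
  have sR : HasStrictDerivAt R (S τ) τ := hasStrictDerivAt_of_hasDerivAt_of_continuousAt
    (Eventually.of_forall h.hasDerivAt_R) cS.continuousAt
  have sS : HasStrictDerivAt S (T * S τ - D * R τ + 1) τ :=
    hasStrictDerivAt_of_hasDerivAt_of_continuousAt (f' := fun t => T * S t - D * R t + 1)
      (Eventually.of_forall h.hasDerivAt_S) (by fun_prop)
  have hsnd : HasStrictFDerivAt (fun p : ℝ × ℝ => p.2) (ContinuousLinearMap.snd ℝ ℝ ℝ) (y₀, τ) :=
    hasStrictFDerivAt_snd
  have hfst : HasStrictFDerivAt (fun p : ℝ × ℝ => p.1) (ContinuousLinearMap.fst ℝ ℝ ℝ) (y₀, τ) :=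
    hasStrictFDerivAt_fst
  have dF := ((sR.hasStrictFDerivAt.comp (y₀, τ) hsnd).const_mul a).sub
    (hfst.mul (sS.hasStrictFDerivAt.comp (y₀, τ) hsnd))
  have hFt : a * S τ - y₀ * (T * S τ - D * R τ + 1) = -z := by
    rw [← hY]
    have : a * R τ - y₀ * S τ = 0 := hx
    unfold orbitY; linear_combination T * this
  set f : ℝ × ℝ → ℝ := fun p => orbitX a R S p.1 p.2 with hf
  obtain ⟨f', hf', hf'inr⟩ : ∃ f' : ℝ × ℝ →L[ℝ] ℝ, HasStrictFDerivAt f f' (y₀, τ) ∧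
      f' (0, 1) = -z := ⟨_, dF, by simp; linarith⟩
  have hinv : (f' ∘L .inr ℝ ℝ ℝ).IsInvertible := by
    refine ⟨ContinuousLinearEquiv.unitsEquivAut ℝ (Units.mk0 (-z) (by linarith)), ?_⟩
    ext
    simp [hf'inr]
  set g := hf'.implicitFunctionOfProdDomain hinv with hg
  have hgd : DifferentiableAt ℝ g y₀ :=
    (hf'.hasStrictFDerivAt_implicitFunctionOfProdDomain hinv).hasFDerivAt.differentiableAt
  have hg0 : g y₀ = τ :=
    (hf'.eventually_apply_eq_iff_implicitFunctionOfProdDomain hinv).self_of_nhds.1 rfl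
  have hgx : ∀ᶠ y in 𝓝 y₀, orbitX a R S y (g y) = 0 := by
    filter_upwards [hf'.eventually_apply_implicitFunctionOfProdDomain hinv] with y hyy
    exact hyy.trans hx
  have hgc : Tendsto g (𝓝 y₀) (𝓝 τ) := by
    have := hgd.continuousAt.tendsto
    rwa [hg0] at this
  refine ⟨g, hg0, ?_, ?_⟩
  · have h1 : HasDerivAt (fun y => orbitX a R S y (g y)) (-S τ + -z * deriv g y₀) y₀ := by
      have dR : HasDerivAt (fun y => R (g y)) (S τ * deriv g y₀) y₀ := by
        have := h.hasDerivAt_R (g y₀)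
        rw [hg0] at this
        exact (hg0 ▸ this : HasDerivAt R (S τ) (g y₀)).comp y₀ hgd.hasDerivAt
      have dS : HasDerivAt (fun y => S (g y)) ((T * S τ - D * R τ + 1) * deriv g y₀) y₀ := by
        have := h.hasDerivAt_S (g y₀)
        rw [hg0] at this
        exact (hg0 ▸ this : HasDerivAt S _ (g y₀)).comp y₀ hgd.hasDerivAt
      refine ((dR.const_mul a).sub ((hasDerivAt_id y₀).mul dS)).congr_deriv ?_
      rw [hg0, ← hFt]; simp; ring
    have h2 : -S τ + -z * deriv g y₀ = 0 :=
      h1.unique ((hasDerivAt_const y₀ (0 : ℝ)).congr_of_eventuallyEq hgx)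
    have h3 : deriv g y₀ = -(S τ / z) := by
      have := hz.ne
      field_simp; linarith
    exact h3 ▸ hgd.hasDerivAt
  · have hbefore : ∀ᶠ y in 𝓝 y₀, ∀ t ∈ Icc 0 (τ + 1), 0 < t → t < g y →
        orbitX a R S y (g y) = 0 → orbitX a R S y t < 0 := by
      refine isCompact_Icc.eventually_forall_of_forall_eventually fun t ht => ?_
      have hgp : Tendsto (fun p : ℝ × ℝ => g p.1) (𝓝 (y₀, t)) (𝓝 τ) :=
        hgc.comp continuous_fst.continuousAt
      rcases ht.1.eq_or_lt with rfl | ht0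
      · exact (h.eventually_neg_at_start hy).mono fun p hp h0 _ _ => hp h0
      rcases lt_trichotomy t τ with htτ | rfl | htτ
      · exact (h.eventually_neg_inside (hneg t ⟨ht0, htτ⟩)).mono fun p hp _ _ _ => hp
      · obtain ⟨ε, hε, hm⟩ := h.exists_strictMonoOn (a := a) (y₀ := y₀) (t₀ := t) (c := 1)
          (by rw [hx, hY]; linarith)
        filter_upwards [prod_mem_nhds (Metric.ball_mem_nhds y₀ hε) (Metric.ball_mem_nhds t hε),
          hgp (Metric.ball_mem_nhds t hε)] with p hp hgp _ hlt h0
        have := hm p.1 hp.1 hp.2 hgp hlt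
        simp only [one_mul, h0] at this
        exact this
      · have hp2 : Tendsto (fun p : ℝ × ℝ => p.2) (𝓝 (y₀, t)) (𝓝 t) :=
          continuous_snd.continuousAt
        filter_upwards [hgp.eventually_lt hp2 htτ] with p hp _ hlt
        exact absurd hlt hp.not_gt
    filter_upwards [hbefore, hgx, hgc.eventually_const_lt hτ,
      hgc.eventually_lt_const (by linarith : τ < τ + 1)] with y h1 h2 h3 h4
    exact h.leftReturn_iff.2 ⟨g y, h3, h2, rfl,
      fun t ht => h1 t ⟨ht.1.le, by linarith [ht.2]⟩ ht.1 ht.2 h2⟩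

/-- The half-map solves the differential equation `z W(y) dz = y W(z) dy`. -/
theorem IsStepResponse.hasDerivAt_leftMap (h : IsStepResponse T D R S) {y₀ τ z : ℝ}
    (hy : 0 < y₀) (hz : z < 0) (hτ : 0 < τ) (hx : orbitX a R S y₀ τ = 0)
    (hY : orbitY T D a R S y₀ τ = z) (hneg : ∀ t ∈ Ioo 0 τ, orbitX a R S y₀ t < 0) :
    HasDerivAt (leftMap T D a) (y₀ * polyW T D a z / (z * polyW T D a y₀)) y₀ := by
  obtain ⟨g, hg0, hg, hret⟩ := h.exists_flightTime hy hz hτ hx hY hneg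
  have hW := polyW_ne_zero_of_return hy hz.le hx hY
  have dR : HasDerivAt (fun y => R (g y)) (S τ * -(S τ / z)) y₀ :=
    (hg0.symm ▸ h.hasDerivAt_R τ : HasDerivAt R (S τ) (g y₀)).comp y₀ hg
  have dS : HasDerivAt (fun y => S (g y)) ((T * S τ - D * R τ + 1) * -(S τ / z)) y₀ :=
    (hg0.symm ▸ h.hasDerivAt_S τ : HasDerivAt S (T * S τ - D * R τ + 1) (g y₀)).comp y₀ hg
  have dY : HasDerivAt (fun y => orbitY T D a R S y (g y)) (1 - D * R τ + a * (S τ / z)) y₀ := by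
    refine (((hasDerivAt_id y₀).mul ((dR.const_mul D).const_sub 1)).add
      (((dR.const_mul T).sub dS).const_mul a)).congr_deriv ?_
    have : a * R τ - y₀ * S τ = 0 := hx
    simp only [hg0, id]
    linear_combination (-D * (S τ / z)) * this
  have heq : leftMap T D a =ᶠ[𝓝 y₀] fun y => orbitY T D a R S y (g y) :=
    hret.mono fun y hyy => hyy.leftMap_eq
  refine (dY.congr_of_eventuallyEq heq).congr_deriv ?_
  have hS := return_relation_S (sub_eq_zero.1 hx) hY
  have hQ := return_relation_derivS (sub_eq_zero.1 hx) hY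
  rw [eq_div_iff (mul_ne_zero hz.ne hW)]
  have e : (1 - D * R τ + a * (S τ / z)) * (z * polyW T D a y₀) =
      z * ((T * S τ - D * R τ + 1) * polyW T D a y₀) - (T * z - a) * (S τ * polyW T D a y₀) := by
    have := hz.ne
    field_simp; ring
  rw [e, hS, hQ]
  unfold polyW; ring

end

/-- At interior points of the domain the orbit starts above and returns strictly below the
origin. -/
theorem exists_return_of_mem_interior {T D a : ℝ} {R S : ℝ → ℝ} (h : IsStepResponse T D R S)
    {y : ℝ} (hy : y ∈ interior (leftDomain T D a)) :
    0 < y ∧ leftMap T D a y < 0 ∧ ∃ τ, 0 < τ ∧ orbitX a R S y τ = 0 ∧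
      orbitY T D a R S y τ = leftMap T D a y ∧ ∀ t ∈ Ioo 0 τ, orbitX a R S y t < 0 := by
  have hpos : ∀ y ∈ interior (leftDomain T D a), 0 < y := fun y hy => by
    have : y ∈ interior (Ici (0 : ℝ)) := interior_mono (fun _ h => h.1) hy
    rwa [interior_Ici] at this
  have hret : ∀ y ∈ interior (leftDomain T D a), ∃ z, LeftReturn T D a y z := fun y hy =>
    (interior_subset hy).2.resolve_right fun h0 => (hpos y hy).ne' h0.1
  obtain ⟨z, hz⟩ := hret y hy
  rw [hz.leftMap_eq]
  obtain ⟨τ, hτ, hx, hY, hneg⟩ := h.leftReturn_iff.1 hz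
  refine ⟨hpos y hy, lt_of_le_of_ne (h.return_nonpos hτ hx hY hneg) ?_, τ, hτ, hx, hY, hneg⟩
  rw [← hY]
  exact h.return_ne_zero (hpos y hy) hτ hx hneg
    (eventually_of_mem (isOpen_interior.mem_nhds hy) hret)

theorem hasDerivAt_polyW (T D a y : ℝ) : HasDerivAt (polyW T D a) (2 * D * y - a * T) y := by
  refine (((((hasDerivAt_id y).pow 2).const_mul D).sub
    ((hasDerivAt_id y).const_mul (a * T))).add_const (a ^ 2)).congr_deriv ?_
  simp; ring

end PoincareHalfMap

open PoincareHalfMap in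
theorem proposition7 (T D a : ℝ) (had : a ^ 2 + D ^ 2 ≠ 0) :
    ∀ y₀ ∈ interior (PoincareHalfMap.leftDomain T D a),
      DifferentiableAt ℝ (PoincareHalfMap.leftMap T D a) y₀ ∧
      DifferentiableAt ℝ (deriv (PoincareHalfMap.leftMap T D a)) y₀ ∧
      SignType.sign (deriv (deriv (PoincareHalfMap.leftMap T D a)) y₀) =
        -SignType.sign (a ^ 2 * T) := by
  intro y₀ hy₀
  obtain ⟨R, S, h⟩ := exists_isStepResponse T D
  have hd : ∀ y ∈ interior (leftDomain T D a), HasDerivAt (leftMap T D a)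
      (y * polyW T D a (leftMap T D a y) / (leftMap T D a y * polyW T D a y)) y := fun y hy => by
    obtain ⟨hpos, hz, τ, hτ, hx, hY, hneg⟩ := exists_return_of_mem_interior h hy
    exact h.hasDerivAt_leftMap hpos hz hτ hx hY hneg
  obtain ⟨hpos, hz, τ, hτ, hx, hY, hneg⟩ := exists_return_of_mem_interior h hy₀
  have hW := polyW_ne_zero_of_return hpos hz.le hx hY
  have heq : deriv (leftMap T D a) =ᶠ[𝓝 y₀] fun y =>
      y * polyW T D a (leftMap T D a y) / (leftMap T D a y * polyW T D a y) :=
    eventually_of_mem (isOpen_interior.mem_nhds hy₀) fun y hy => (hd y hy).deriv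
  have hd2 : HasDerivAt (deriv (leftMap T D a))
      (a ^ 2 * polyW T D a (leftMap T D a y₀) * (leftMap T D a y₀ ^ 2 - y₀ ^ 2) /
        (leftMap T D a y₀ ^ 3 * polyW T D a y₀ ^ 2)) y₀ := by
    refine HasDerivAt.congr_of_eventuallyEq ?_ heq
    refine (((hasDerivAt_id y₀).mul ((hasDerivAt_polyW T D a _).comp y₀ (hd y₀ hy₀))).div
      ((hd y₀ hy₀).mul (hasDerivAt_polyW T D a y₀)) (mul_ne_zero hz.ne hW)).congr_deriv ?_
    have hz' := hz.ne
    simp only [id, Function.comp, Pi.mul_apply]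
    clear heq hd
    generalize leftMap T D a y₀ = z at *
    -- The terms in `W` and `W'` collapse because `W(y) - y W'(y) = a² - D y²`.
    have e : polyW T D a y₀ = D * y₀ ^ 2 - a * T * y₀ + a ^ 2 := rfl
    have e' : polyW T D a z = D * z ^ 2 - a * T * z + a ^ 2 := rfl
    field_simp
    rw [e, e']
    ring
  refine ⟨(hd y₀ hy₀).differentiableAt, hd2.differentiableAt, ?_⟩
  rw [hd2.deriv]
  by_cases ha : a = 0
  · simp [ha]
  have hWpos := h.polyW_pos ha hτ hpos hz hx hY
  have hWzpos : 0 < polyW T D a (leftMap T D a y₀) := by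
    rw [h.polyW_return hpos hz.le hx hY]
    exact mul_pos (Real.exp_pos _) hWpos
  obtain ⟨A, hA, hAe⟩ := (h.isSolution a y₀).exists_sq_sub_sq hτ (h.orbitX_zero y₀) hx
    (by rw [h.orbitY_zero]; exact hpos.ne')
  rw [hY, h.orbitY_zero] at hAe
  rw [hAe]
  have e : a ^ 2 * polyW T D a (leftMap T D a y₀) * (T * A) /
        (leftMap T D a y₀ ^ 3 * polyW T D a y₀ ^ 2) =
      a ^ 2 * T * (polyW T D a (leftMap T D a y₀) * A /
        (leftMap T D a y₀ ^ 3 * polyW T D a y₀ ^ 2)) := by ring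
  have hneg' : polyW T D a (leftMap T D a y₀) * A /
        (leftMap T D a y₀ ^ 3 * polyW T D a y₀ ^ 2) < 0 :=
    div_neg_of_pos_of_neg (mul_pos hWzpos hA)
      (mul_neg_of_neg_of_pos (Odd.pow_neg (by decide) hz) (by positivity))
  rw [e, sign_mul, sign_neg hneg', mul_neg, mul_one]
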